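/- All graphs are finite and simple. Fix an integer $k\ge 1$ and let $d_k(x,y)=\min\{d(x,y),k+1\}$, where $d$ is the graph distance. A set $S$ of vertices of a graph $G$ is a \emph{threshold-$k$ resolving set} if for any two distinct vertices $x,y$ there is $s\in S$ with $d_k(s,x)\ne d_k(s,y)$, and for every vertex $x$ there is $s\in S$ with $d_k(s,x)\le k$. The \emph{threshold-$k$ metric dimension} $\mathrm{Tmd}_k(G)$ is the smallest cardinality of such a set. Let $T$ be a tree. A \emph{leaf-path} starting at a vertex $v$ with $\deg v\ge 3$ is an induced path in $T$ from $v$ to a leaf (a vertex of degree $1$), all of whose vertices other than its two ends have degree $2$. Let $\mathcal L_v=\{\mathcal P^{(v)}_1,\dots,\mathcal P^{(v)}_{L_v}\}$ be the collection of leaf-paths starting at $v$, let $\ell(v,j)$ be the length (number of edges) of $\mathcal P^{(v)}_j$, and let $F_T=\{v\in T:\deg v\ge 3,\ L_v\ge 2\}$ be the set of \emph{support vertices}. For an integer $\ell\ge 1$ write $\ell=q(3k+2)+r$ with integers $q\ge 0$ and $0\le r\le 3k+1$, and define the \emph{upper} and \emph{lower complexity} \[ \bar c(\ell)=2q+\mathbf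 1_{\{r\ge 1\}}+\mathbf 1_{\{r\ge 2k+2\}},\qquad \underline c(\ell)=2q+\mathbf 1_{\{r\ge k+1\}}+\mathbf 1_{\{r\ge 2k+2\}}. \] For $v\in F_T$ put \[ R(\mathcal L_v)=\sum_{j=1}^{L_v}\bar c(\ell(v,j))-\max_{1\le j\le L_v}\bigl\{\bar c(\ell(v,j))-\underline c(\ell(v,j))\bigr\}. \] \textbf{Theorem.} Let $T$ be a tree with $n\ge 1$ vertices and let $k\ge 1$. Then \[ \mathrm{Tmd}_k(T)\ \ge\ \left\lceil\frac{3n-3\sum_{v\in F_T}\sum_{j=1}^{L_v}\ell(v,j)+k^2+k+\mathbf 1_{\{k\equiv 1\ (\mathrm{mod}\ 3)\}}}{k^2+4k+3+\mathbf 1_{\{k\equiv 1\ (\mathrm{mod}\ 3)\}}}\right\rceil+\sum_{v\in F_T}R(\mathcal L_v)-|F_T|. \] -/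

import Mathlib

namespace ThresholdDim

section Resolving

variable {V : Type*}

/-- The truncated distance `d_k(x, y) = min (d(x, y)) (k + 1)`. The extended distance is used, so
that vertices in different components are at distance `∞`, truncated to `k + 1`. -/
noncomputable def truncDist (G : SimpleGraph V) (k : ℕ) (x y : V) : ℕ∞ :=
  min (G.edist x y) ((k : ℕ∞) + 1)

/-- `S` is a threshold-`k` resolving set: every pair of distinct vertices is resolved by a sensor
in `S`, and every vertex is measured by a sensor in `S`. -/
def IsThresholdResolving (G : SimpleGraph V) (k : ℕ) (S : Finset V) : Prop :=
  (∀ x y : V, x ≠ y → ∃ s ∈ S, truncDist G k s x ≠ truncDist G k s y) ∧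
    ∀ x : V, ∃ s ∈ S, truncDist G k s x ≤ (k : ℕ∞)

/-- The threshold-`k` metric dimension `Tmd_k(G)` of a finite graph: the smallest cardinality of a
threshold-`k` resolving set. -/
noncomputable def tmd (G : SimpleGraph V) (k : ℕ) : ℕ :=
  sInf {m : ℕ | ∃ S : Finset V, IsThresholdResolving G k S ∧ S.card = m}

/-- The set of all vertices is always resolving, so the minimum defining `tmd` is over a nonempty
set. -/
theorem isThresholdResolving_univ [Fintype V] (G : SimpleGraph V) (k : ℕ) :
    IsThresholdResolving G k Finset.univ := by
  refine ⟨fun x y hxy => ⟨x, Finset.mem_univ x, ?_⟩, fun x => ⟨x, Finset.mem_univ x, ?_⟩⟩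
  · have h : 0 < min (G.edist x y) ((k : ℕ∞) + 1) :=
      lt_min (SimpleGraph.edist_pos_of_ne hxy) (by positivity)
    simpa [truncDist] using h.ne
  · simp [truncDist]

theorem exists_card_eq_tmd [Fintype V] (G : SimpleGraph V) (k : ℕ) :
    ∃ S : Finset V, IsThresholdResolving G k S ∧ S.card = tmd G k :=
  Nat.sInf_mem (s := {m : ℕ | ∃ S : Finset V, IsThresholdResolving G k S ∧ S.card = m})
    ⟨_, Finset.univ, isThresholdResolving_univ G k, rfl⟩

end Resolving

/-- The upper complexity `c̄(ℓ)`; here `ℓ = q (3k+2) + r` with `0 ≤ r ≤ 3k+1`. -/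
def upperComplexity (k l : ℕ) : ℕ :=
  2 * (l / (3 * k + 2)) + (if 1 ≤ l % (3 * k + 2) then 1 else 0)
    + (if 2 * k + 2 ≤ l % (3 * k + 2) then 1 else 0)

/-- The lower complexity `c̲(ℓ)`; here `ℓ = q (3k+2) + r` with `0 ≤ r ≤ 3k+1`. -/
def lowerComplexity (k l : ℕ) : ℕ :=
  2 * (l / (3 * k + 2)) + (if k + 1 ≤ l % (3 * k + 2) then 1 else 0)
    + (if 2 * k + 2 ≤ l % (3 * k + 2) then 1 else 0)

/-- The natural-number subtraction `c̄(ℓ) - c̲(ℓ)` never truncates. -/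
theorem lowerComplexity_le_upperComplexity (k l : ℕ) :
    lowerComplexity k l ≤ upperComplexity k l := by
  unfold lowerComplexity upperComplexity
  split_ifs <;> omega

section LeafPaths

variable {V : Type*} [Fintype V] [DecidableEq V] (G : SimpleGraph V) [DecidableRel G.Adj]

/-- The walk `p` from `v` to `w` is a leaf-path starting at `v`: it is a path, induced in `G`, its
end vertex `v` has degree at least 3, its other end vertex `w` is a leaf, and all its other
vertices have degree 2. As the two ends have different degrees, a leaf-path has exactly one
description as such a walk. -/
def IsLeafPath {v w : V} (p : G.Walk v w) : Prop :=
  p.IsPath ∧ (∀ a ∈ p.support, ∀ b ∈ p.support, G.Adj a b → s(a, b) ∈ p.edges) ∧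
    3 ≤ G.degree v ∧ G.degree w = 1 ∧ ∀ u ∈ p.support, u ≠ v → u ≠ w → G.degree u = 2

instance {v w : V} (p : G.Walk v w) : Decidable (IsLeafPath G p) :=
  haveI : Decidable p.IsPath := decidable_of_iff _ p.isPath_def.symm
  haveI : Decidable (∀ a ∈ p.support, ∀ b ∈ p.support, G.Adj a b → s(a, b) ∈ p.edges) :=
    inferInstance
  haveI : Decidable (∀ u ∈ p.support, u ≠ v → u ≠ w → G.degree u = 2) := inferInstance
  inferInstanceAs (Decidable (_ ∧ _ ∧ _ ∧ _ ∧ _))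

/-- The collection `𝓛_v` of leaf-paths starting at `v` (each recorded with its leaf). -/
def leafPaths (v : V) : Finset (Σ w : V, G.Path v w) :=
  Finset.univ.filter fun P => IsLeafPath G P.2.1

/-- The length (number of edges) of a path. -/
def pathLength {v : V} (P : Σ w : V, G.Path v w) : ℕ := P.2.1.length

/-- The set `F_T` of support vertices: degree at least 3 and at least two leaf-paths. -/
def supportVertices : Finset V :=
  Finset.univ.filter fun v => 3 ≤ G.degree v ∧ 2 ≤ (leafPaths G v).card

/-- `R(𝓛_v)`: the sum of the upper complexities of the leaf-paths at `v`, minus the maximum of the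
differences between upper and lower complexity. (The maximum is over a nonempty family when `v` is
a support vertex.) -/
def leafPathSensors (k : ℕ) (v : V) : ℤ :=
  (∑ P ∈ leafPaths G v, (upperComplexity k (pathLength G P) : ℤ))
    - (((leafPaths G v).sup fun P =>
        upperComplexity k (pathLength G P) - lowerComplexity k (pathLength G P) : ℕ) : ℤ)

end LeafPaths

end ThresholdDim

namespace ThresholdDim

/-! ### Geodesics, medians and separating vertices in a tree -/

section TreeMetric

variable {V : Type*} {T : SimpleGraph V}

/-! Let `S` be a minimum resolving set and let `U` be the set of vertices on the leaf-paths at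
support vertices, without the support vertices. The sensors inside and outside `U` are counted
separately.

Inside `U`: a sensor off a leaf-path measures only vertices among its first `k`, and sees the path
in order of distance from `v`. Hence the sensors on the path resolve the positions `k < i ≤ ℓ` by
themselves. On a line, two sensors resolve at most `3k+2` consecutive positions and one at most
`k+1`, so at least the lower complexity is needed, and at least the upper one if a sensor occupies
one of the first `k+1` positions. Two paths at `v` cannot both fall below the upper complexity,
because their first vertices would not be told apart. This gives `leafPathSensors_le`.

Outside `U`: a sensor in `U` sees the complement of `U` through a support vertex, which can replace
it. So `(S \ U) ∪ F_T` resolves the complement of `U`, and it remains to bound how many vertices `m`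
sensors in a tree resolve. One sensor resolves at most `k+1`, and each further one adds at most
`gain k / 3`. For the induction, remove a sensor `t` that a vertex `u` separates from the rest,
together with a sibling `c` no farther from `u`. The signatures lost are those measured by `t` alone
and those not maximal at `t` among signatures agreeing elsewhere. The latter are determined by the
distances to `t` and to the nearest other sensor `s`. With `D = d(s,t)` the loss is at most `min D
(k+1) + positionCount k D`, and optimizing over `D` yields `gain k`. -/

theorem dist_eq_add_of_mem_support (hc : T.Connected) {a b u : V} {p : T.Walk a b}
    (hp : p.length = T.dist a b) (hu : u ∈ p.support) :
    T.dist a b = T.dist a u + T.dist u b := by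
  classical
  have h1 := congrArg SimpleGraph.Walk.length (p.take_spec hu)
  rw [SimpleGraph.Walk.length_append] at h1
  have h2 := SimpleGraph.dist_le (p.takeUntil u hu)
  have h3 := SimpleGraph.dist_le (p.dropUntil u hu)
  have h4 := hc.dist_triangle (u := a) (v := u) (w := b)
  omega

theorem length_eq_dist_of_isPath (hT : T.IsTree) {a b : V} {p : T.Walk a b} (hp : p.IsPath) :
    p.length = T.dist a b := by
  obtain ⟨q, hq, hl⟩ := hT.connected.exists_path_of_dist a b
  have : p = q := congrArg Subtype.val
    ((hT.isAcyclic.subsingleton_path a b).elim ⟨p, hp⟩ ⟨q, hq⟩)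
  rw [← hl, this]

/-- A vertex between `a` and `b` lies on every walk from `a` to `b`. -/
theorem mem_support_of_dist_eq_add (hT : T.IsTree) {a b u : V}
    (h : T.dist a b = T.dist a u + T.dist u b) (p : T.Walk a b) : u ∈ p.support := by
  classical
  obtain ⟨q, hq⟩ := hT.connected.exists_walk_length_eq_dist a u
  obtain ⟨r, hr⟩ := hT.connected.exists_walk_length_eq_dist u b
  have hpath : (q.append r).IsPath := by
    apply SimpleGraph.Walk.isPath_of_length_eq_dist
    rw [SimpleGraph.Walk.length_append, hq, hr, h]
  have : q.append r = p.toPath := congrArg Subtype.val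
    ((hT.isAcyclic.subsingleton_path a b).elim ⟨q.append r, hpath⟩ p.toPath)
  have h2 : u ∈ (q.append r).support := by simp
  rw [this] at h2
  exact p.support_bypass_subset_support h2

/-- In a tree, a vertex between `a` and `b` is between `a` and `y` or between `b` and `y`. -/
theorem between_or (hT : T.IsTree) {a b u : V}
    (h : T.dist a b = T.dist a u + T.dist u b) (y : V) :
    T.dist a y = T.dist a u + T.dist u y ∨ T.dist b y = T.dist b u + T.dist u y := by
  obtain ⟨p, hp⟩ := hT.connected.exists_walk_length_eq_dist a y
  obtain ⟨q, hq⟩ := hT.connected.exists_walk_length_eq_dist b y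
  have := mem_support_of_dist_eq_add hT h (p.append q.reverse)
  rw [SimpleGraph.Walk.mem_support_append_iff, SimpleGraph.Walk.support_reverse,
    List.mem_reverse] at this
  exact this.imp (dist_eq_add_of_mem_support hT.connected hp)
    (dist_eq_add_of_mem_support hT.connected hq)

theorem exists_adj_between (hc : T.Connected) {a b : V} (hne : a ≠ b) :
    ∃ c, T.Adj a c ∧ T.dist a b = T.dist c b + 1 := by
  obtain ⟨p, hp⟩ := hc.exists_walk_length_eq_dist a b
  cases p with
  | nil => exact absurd rfl hne
  | @cons _ v _ h q =>
    refine ⟨v, h, ?_⟩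
    rw [SimpleGraph.Walk.length_cons] at hp
    have h1 := SimpleGraph.dist_le q
    have h3 := SimpleGraph.dist_eq_one_iff_adj.2 h
    have := hc.dist_triangle (u := a) (v := v) (w := b)
    omega

theorem exists_median [Finite V] (hT : T.IsTree) (a b c : V) :
    ∃ m, T.dist a b = T.dist a m + T.dist m b ∧ T.dist a c = T.dist a m + T.dist m c ∧
      T.dist b c = T.dist b m + T.dist m c := by
  have hc := hT.connected
  -- `m` is the last common vertex of the geodesics from `a` to `b` and to `c`. The next vertex `m'`
  -- towards `b` is off the geodesic to `c`, so it is one step farther from `c` than `m`, and by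
  -- `between_or` it lies between `b` and `c`.
  obtain ⟨m, ⟨hm1, hm2⟩, hmax⟩ := Set.exists_max_image
    {m | T.dist a b = T.dist a m + T.dist m b ∧ T.dist a c = T.dist a m + T.dist m c}
    (fun m => T.dist a m) (Set.toFinite _) ⟨a, by simp⟩
  refine ⟨m, hm1, hm2, ?_⟩
  by_cases hmb : m = b
  · simp [hmb]
  obtain ⟨m', hadj, hm'⟩ := exists_adj_between hc hmb
  have hne := hT.dist_ne_of_adj c hadj
  have h1 := SimpleGraph.dist_eq_one_iff_adj.2 hadj
  have t1 := hc.dist_triangle (u := a) (v := m) (w := m')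
  have t2 := hc.dist_triangle (u := a) (v := m') (w := b)
  have t3 := hc.dist_triangle (u := m) (v := m') (w := c)
  have t4 := hc.dist_triangle (u := a) (v := m') (w := c)
  have t5 := hc.dist_triangle (u := m') (v := m) (w := c)
  have c1 := T.dist_comm (u := m) (v := m')
  have c2 := T.dist_comm (u := c) (v := m')
  have c3 := T.dist_comm (u := c) (v := m)
  have c4 := T.dist_comm (u := b) (v := m')
  have c5 := T.dist_comm (u := b) (v := m)
  have hbtw : T.dist a b = T.dist a m' + T.dist m' b := by omega
  have hnot : ¬ T.dist a c = T.dist a m' + T.dist m' c := fun h => by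
    have : T.dist a m' ≤ T.dist a m := hmax m' ⟨hbtw, h⟩
    omega
  have := (between_or hT hbtw c).resolve_left hnot
  omega

/-- The three distances add up to twice the total distance to the median. -/
theorem dist_parity [Finite V] (hT : T.IsTree) (a b c : V) :
    (T.dist a c + T.dist b c + T.dist a b) % 2 = 0 := by
  obtain ⟨m, h1, h2, h3⟩ := exists_median hT a b c
  have := T.dist_comm (u := b) (v := m)
  omega

/-- Any two sensors admit a refinement to two distinct sensors `c₁`, `c₂` and a vertex `u` which
separates each of them from all other sensors. -/
theorem exists_separating_pair [Finite V] (hT : T.IsTree) {S : Finset V} (hS : 2 ≤ S.card) :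
    ∃ u, ∃ c₁ ∈ S, ∃ c₂ ∈ S, c₁ ≠ c₂ ∧
      (∀ r ∈ S, r ≠ c₁ → T.dist r c₁ = T.dist r u + T.dist u c₁) ∧
      (∀ r ∈ S, r ≠ c₂ → T.dist r c₂ = T.dist r u + T.dist u c₂) := by
  have hc := hT.connected
  obtain ⟨ρ, hρ, σ, hσ, hne⟩ := Finset.one_lt_card.1 hS
  -- Root the tree at the sensor `ρ` and take `u` as deep as possible among the vertices lying on
  -- the geodesics from `ρ` to two distinct sensors.
  obtain ⟨⟨u, c₁, c₂⟩, ⟨hc₁, hc₂, hcc, h1, h2⟩, hmax⟩ := Set.exists_max_image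
    {t : V × V × V | t.2.1 ∈ S ∧ t.2.2 ∈ S ∧ t.2.1 ≠ t.2.2 ∧
      T.dist ρ t.2.1 = T.dist ρ t.1 + T.dist t.1 t.2.1 ∧
      T.dist ρ t.2.2 = T.dist ρ t.1 + T.dist t.1 t.2.2}
    (fun t => T.dist ρ t.1) (Set.toFinite _) ⟨(ρ, ρ, σ), by simp [hρ, hσ, hne]⟩
  have key : ∀ c ∈ S, T.dist ρ c = T.dist ρ u + T.dist u c →
      ∀ r ∈ S, r ≠ c → T.dist r c = T.dist r u + T.dist u c := by
    intro c hcS hu r hr hrc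
    -- The geodesics from `ρ` to `c` and to `r` part at `m`, which is no deeper than `u` by
    -- maximality. The geodesic from `r` joins the one to `c` at `m` and so still passes `u`.
    obtain ⟨m, m1, m2, m3⟩ := exists_median hT ρ c r
    have hle : T.dist ρ m ≤ T.dist ρ u := hmax (m, r, c) ⟨hr, hcS, hrc, m2, m1⟩
    have hb : T.dist m c = T.dist m u + T.dist u c := by
      have cm := T.dist_comm (u := c) (v := m)
      have cu := T.dist_comm (u := c) (v := u)
      have cmu := T.dist_comm (u := u) (v := m)
      rcases between_or hT hu m with h | h
      · have : T.dist u m = 0 := by omega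
        omega
      · omega
    have t := hc.dist_triangle (u := r) (v := m) (w := u)
    have t' := hc.dist_triangle (u := r) (v := u) (w := c)
    have e1 := T.dist_comm (u := r) (v := m)
    have e2 := T.dist_comm (u := r) (v := c)
    have e3 := T.dist_comm (u := m) (v := c)
    omega
  exact ⟨u, c₁, hc₁, c₂, hc₂, hcc, key c₁ hc₁ h1, key c₂ hc₂ h2⟩

end TreeMetric

/-! ### The number of positions relative to two sensors, and its optimum -/

section Arithmetic

/-- The pairs of values at two sensors at distance `D` that a vertex measured by both can have,
except for those attained only when the first sensor lies between the vertex and the second. -/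
def valuePairs (k D : ℕ) : Finset (ℕ × ℕ) :=
  (Finset.range (k + 1) ×ˢ Finset.range (k + 1)).filter fun p =>
    D ≤ p.1 + p.2 ∧ p.2 < p.1 + D ∧ p.1 ≤ p.2 + D ∧ (p.1 + p.2 + D) % 2 = 0

/-- The number of positions `(b, h)`: `h` is the height above the vertex at distance `b` from the
first of two sensors at distance `D`. -/
def positionCount (k D : ℕ) : ℕ :=
  ∑ b ∈ Finset.range D, (k + 1 - max (b + 1) (D - (b + 1)))

theorem card_valuePairs_le (k D : ℕ) : (valuePairs k D).card ≤ positionCount k D := by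
  have hsub : valuePairs k D ⊆ ((Finset.range D).sigma fun b =>
      Finset.range (k + 1 - max (b + 1) (D - (b + 1)))).image
        fun x => (x.1 + 1 + x.2, D - (x.1 + 1) + x.2) := by
    rintro ⟨α, β⟩ h
    simp only [valuePairs, Finset.mem_filter, Finset.mem_product, Finset.mem_range] at h
    simp only [Finset.mem_image, Finset.mem_sigma, Finset.mem_range, Sigma.exists, Prod.mk.injEq]
    -- Solve `α = b + h`, `β = D - b + h`. The strict inequality `β < α + D` means `b ≥ 1`, and the
    -- summation index is `b - 1`.
    exact ⟨(D + α - β) / 2 - 1, (α + β - D) / 2, by omega, by omega, by omega⟩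
  refine (Finset.card_le_card hsub).trans (Finset.card_image_le.trans ?_)
  simp [positionCount]

/-- Shifting `b` by one matches the inner terms, since both distances grow by one along with `k`;
only the two end terms are new. This drives the inductions for the closed forms below. -/
theorem positionCount_add_two (k D : ℕ) :
    positionCount (k + 1) (D + 2) = (k + 1 - D) + positionCount k D + (k - D) := by
  unfold positionCount
  rw [Finset.sum_range_succ, Finset.sum_range_succ']
  have : ∑ b ∈ Finset.range D, (k + 1 + 1 - max (b + 1 + 1) (D + 2 - (b + 1 + 1))) =
      ∑ b ∈ Finset.range D, (k + 1 - max (b + 1) (D - (b + 1))) :=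
    Finset.sum_congr rfl fun b hb => by
      rw [Finset.mem_range] at hb
      omega
  rw [this]
  omega

theorem positionCount_zero_left (D : ℕ) : positionCount 0 D = 0 := by
  unfold positionCount
  refine Finset.sum_eq_zero fun b hb => ?_
  omega

theorem positionCount_even (e : ℕ) : ∀ k : ℕ,
    (2 * e ≤ k + 1 → (positionCount k (2 * e) : ℤ) = 2 * e * k + 2 * e - 3 * e ^ 2) ∧
    (k + 1 ≤ 2 * e → e ≤ k + 1 → (positionCount k (2 * e) : ℤ) = (k + 1 - e) ^ 2) ∧
    (k + 1 ≤ e → positionCount k (2 * e) = 0) := by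
  induction e with
  | zero =>
    intro k
    simp [positionCount]
  | succ e ih =>
    intro k
    rcases k with _ | k
    · rw [positionCount_zero_left]
      refine ⟨fun h => by omega, fun h1 h2 => ?_, fun _ => rfl⟩
      obtain rfl : e = 0 := by omega
      simp
    · obtain ⟨h1, h2, h3⟩ := ih k
      rw [show 2 * (e + 1) = 2 * e + 2 by ring, positionCount_add_two]
      refine ⟨fun h => ?_, fun h h' => ?_, fun h => ?_⟩
      · have := h1 (by omega)
        have e1 : ((k + 1 - 2 * e : ℕ) : ℤ) = k + 1 - 2 * e := by omega
        have e2 : ((k - 2 * e : ℕ) : ℤ) = k - 2 * e := by omega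
        rw [Nat.cast_add, Nat.cast_add, e1, e2, this]
        push_cast
        ring
      · by_cases hk : k + 1 ≤ 2 * e
        · have := h2 hk (by omega)
          rw [show k + 1 - 2 * e = 0 by omega, show k - 2 * e = 0 by omega]
          push_cast [this]
          ring
        · have := h1 (by omega)
          obtain rfl : k = 2 * e := by omega
          have e1 : 2 * e + 1 - 2 * e = 1 := by omega
          rw [e1, Nat.sub_self]
          push_cast [this]
          ring
      · rw [h3 (by omega)]
        omega

theorem positionCount_odd (e : ℕ) : ∀ k : ℕ,
    (2 * e ≤ k → (positionCount k (2 * e + 1) : ℤ) = 2 * e * k + k - 3 * e ^ 2 - e) ∧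
    (k ≤ 2 * e → e ≤ k → (positionCount k (2 * e + 1) : ℤ) = (k - e) * (k - e + 1)) ∧
    (k ≤ e → positionCount k (2 * e + 1) = 0) := by
  induction e with
  | zero =>
    intro k
    simp [positionCount]
    intro h
    simp [h]
  | succ e ih =>
    intro k
    rcases k with _ | k
    · rw [positionCount_zero_left]
      exact ⟨fun h => by omega, fun h1 h2 => by omega, fun _ => rfl⟩
    · obtain ⟨h1, h2, h3⟩ := ih k
      rw [show 2 * (e + 1) + 1 = (2 * e + 1) + 2 by ring, positionCount_add_two]
      refine ⟨fun h => ?_, fun h h' => ?_, fun h => ?_⟩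
      · have := h1 (by omega)
        have e1 : ((k + 1 - (2 * e + 1) : ℕ) : ℤ) = k - 2 * e := by omega
        have e2 : ((k - (2 * e + 1) : ℕ) : ℤ) = k - 2 * e - 1 := by omega
        rw [Nat.cast_add, Nat.cast_add, e1, e2, this]
        push_cast
        ring
      · by_cases hk : k ≤ 2 * e
        · have := h2 hk (by omega)
          rw [show k + 1 - (2 * e + 1) = 0 by omega, show k - (2 * e + 1) = 0 by omega]
          push_cast [this]
          ring
        · have := h1 (by omega)
          obtain rfl : k = 2 * e + 1 := by omega
          have e1 : 2 * e + 1 + 1 - (2 * e + 1) = 1 := by omega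
          rw [e1, Nat.sub_self]
          push_cast [this]
          ring
      · rw [h3 (by omega)]
        omega

/-- The denominator of the bound: three times the number of vertices gained with a new sensor. -/
def gain (k : ℕ) : ℕ := k ^ 2 + 4 * k + 3 + if k ≡ 1 [MOD 3] then 1 else 0

/-- For `D = 2e ≤ k + 1` the left side is three times the loss `D + positionCount k D`. The
subtracted square can vanish only if `k ≡ 1 (mod 3)` and is at least 1 otherwise, which is the
source of the indicator in the bound. -/
theorem sq_sub_le_gain (k e : ℕ) :
    ((k : ℤ) + 2) ^ 2 - (k + 2 - 3 * e) ^ 2 ≤ gain k := by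
  unfold gain
  by_cases h : k ≡ 1 [MOD 3]
  · rw [if_pos h]
    push_cast
    nlinarith [sq_nonneg ((k : ℤ) + 2 - 3 * e)]
  · rw [if_neg h]
    push_cast
    have : (k : ℤ) + 2 - 3 * e ≠ 0 := fun h0 => h (by unfold Nat.ModEq; omega)
    have := Int.one_le_abs this
    nlinarith [sq_abs ((k : ℤ) + 2 - 3 * e)]

theorem three_mul_positionCount_le {k D : ℕ} (hk : 1 ≤ k) :
    3 * (min D (k + 1) + positionCount k D) ≤ gain k := by
  have hg : ((k : ℤ) + 2) ^ 2 - 1 ≤ gain k := by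
    unfold gain
    push_cast
    split_ifs <;> linarith
  have hg1 : gain 1 = 9 := by decide
  have hg2 : gain 2 = 15 := by decide
  zify
  obtain ⟨e, rfl | rfl⟩ := Nat.even_or_odd' D
  · obtain ⟨h1, h2, h3⟩ := positionCount_even e k
    rcases le_total (2 * e) (k + 1) with h | h
    · rw [h1 h]
      have hmin : min (2 * (e : ℤ)) (k + 1) = 2 * e := by omega
      push_cast
      rw [hmin]
      nlinarith [sq_sub_le_gain k e]
    · have hmin : min (2 * (e : ℤ)) (k + 1) = k + 1 := by omega
      rcases le_total e (k + 1) with h' | h'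
      · rw [h2 h h']
        push_cast
        rw [hmin]
        -- The estimate `4 (k+1-e)² ≤ (k+1)²` is strong enough only from `k = 3` on.
        obtain rfl | rfl | hk3 : k = 1 ∨ k = 2 ∨ 3 ≤ k := by omega
        · have he : e = 1 ∨ e = 2 := by omega
          rcases he with rfl | rfl <;> norm_num [hg1]
        · have he : e = 2 ∨ e = 3 := by omega
          rcases he with rfl | rfl <;> norm_num [hg2]
        · have a1 : (0 : ℤ) ≤ (k : ℤ) + 1 - e := by omega
          have a2 : 2 * ((k : ℤ) + 1 - e) ≤ k + 1 := by omega
          nlinarith [mul_le_mul a2 a2 (by linarith) (by linarith)]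
      · rw [h3 h']
        push_cast
        rw [hmin]
        nlinarith
  · obtain ⟨h1, h2, h3⟩ := positionCount_odd e k
    rcases le_total (2 * e) k with h | h
    · rw [h1 h]
      have hmin : min (2 * (e : ℤ) + 1) (k + 1) = 2 * e + 1 := by omega
      push_cast
      rw [hmin]
      -- A product of two consecutive integers; it equals the difference between `(k+2)² - 1` and
      -- three times the loss.
      have hprod : (0 : ℤ) ≤ (k - 3 * e) * (k - 3 * e + 1) := by
        rcases le_or_gt 0 ((k : ℤ) - 3 * e) with h0 | h0
        · positivity
        · exact mul_nonneg_of_nonpos_of_nonpos h0.le (by omega)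
      nlinarith
    · have hmin : min (2 * (e : ℤ) + 1) (k + 1) = k + 1 := by omega
      rcases le_total e k with h' | h'
      · rw [h2 h h']
        push_cast
        rw [hmin]
        obtain rfl | hk2 : k = 1 ∨ 2 ≤ k := by omega
        · obtain rfl : e = 1 := by omega
          norm_num [hg1]
        · have a1 : (0 : ℤ) ≤ (k : ℤ) - e := by omega
          have a2 : 2 * ((k : ℤ) - e) ≤ k := by omega
          have a3 : 2 * ((k : ℤ) - e + 1) ≤ k + 2 := by omega
          nlinarith [mul_le_mul a2 a3 (by linarith) (by linarith)]
      · rw [h3 h']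
        push_cast
        rw [hmin]
        nlinarith

end Arithmetic

/-! ### The sensor to be removed -/

section Separation

variable {V : Type*} {T : SimpleGraph V}

/-- `t` is a sensor that can be removed: the vertex `u` separates each of the sensors `t` and `c`
from all other sensors, `c` is at least as close to `u` as `t`, and `s` is a closest sensor to `u`
other than `t`. -/
structure Removable (T : SimpleGraph V) (S : Finset V) (u t c s : V) : Prop where
  mem_t : t ∈ S
  mem_c : c ∈ S
  mem_s : s ∈ S
  c_ne : c ≠ t
  s_ne : s ≠ t
  sep_t : ∀ r ∈ S, r ≠ t → T.dist r t = T.dist r u + T.dist u t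
  sep_c : ∀ r ∈ S, r ≠ c → T.dist r c = T.dist r u + T.dist u c
  c_le : T.dist u c ≤ T.dist u t
  s_le : ∀ r ∈ S, r ≠ t → T.dist u s ≤ T.dist u r

theorem exists_removable [Finite V] (hT : T.IsTree) {S : Finset V} (hS : 2 ≤ S.card) :
    ∃ u t c s, Removable T S u t c s := by
  classical
  obtain ⟨u, c₁, h₁, c₂, h₂, hne, sep₁, sep₂⟩ := exists_separating_pair hT hS
  obtain ⟨t, c, ht, hc, hct, sept, sepc, hle⟩ : ∃ t c, t ∈ S ∧ c ∈ S ∧ c ≠ t ∧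
      (∀ r ∈ S, r ≠ t → T.dist r t = T.dist r u + T.dist u t) ∧
      (∀ r ∈ S, r ≠ c → T.dist r c = T.dist r u + T.dist u c) ∧ T.dist u c ≤ T.dist u t := by
    rcases le_total (T.dist u c₁) (T.dist u c₂) with h | h
    · exact ⟨c₂, c₁, h₂, h₁, hne, sep₂, sep₁, h⟩
    · exact ⟨c₁, c₂, h₁, h₂, hne.symm, sep₁, sep₂, h⟩
  obtain ⟨s, hs, hmin⟩ := Finset.exists_min_image (S.erase t) (fun r => T.dist u r)
    ⟨c, Finset.mem_erase.2 ⟨hct, hc⟩⟩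
  exact ⟨u, t, c, s, ht, hc, (Finset.mem_erase.1 hs).2, hct, (Finset.mem_erase.1 hs).1, sept, sepc,
    hle, fun r hr hrt => hmin r (Finset.mem_erase.2 ⟨hrt, hr⟩)⟩

namespace Removable

variable {S : Finset V} {u t c s : V} {k : ℕ}

theorem dist_eq_of_ne (h : Removable T S u t c s) (hT : T.IsTree) {x : V}
    (hx : T.dist t x ≠ T.dist t u + T.dist u x) {r : V} (hr : r ∈ S) (hrt : r ≠ t) :
    T.dist r x = T.dist r u + T.dist u x :=
  (between_or hT (h.sep_t r hr hrt) x).resolve_right hx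

/-- If `t` reaches `x` through `u`, then `s` is no farther from `u` than `t`, as `d(u,s) ≤ d(u,c) ≤
d(u,t)`. Otherwise `r` reaches `x` through `u`, and `s` is no farther from `u` than `r`. -/
theorem dist_s_le (h : Removable T S u t c s) (hT : T.IsTree) {x r : V} (hr : r ∈ S) (hrt : r ≠ t)
    (hrx : T.dist r x ≤ k) (htx : T.dist t x ≤ k) : T.dist s x ≤ k := by
  have h1 := h.s_le r hr hrt
  have h2 := h.s_le c h.mem_c h.c_ne
  have h3 := h.c_le
  have t1 := hT.connected.dist_triangle (u := s) (v := u) (w := x)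
  have e1 := T.dist_comm (u := s) (v := u)
  have e2 := T.dist_comm (u := r) (v := u)
  have e3 := T.dist_comm (u := t) (v := u)
  by_cases hx : T.dist t x = T.dist t u + T.dist u x
  · omega
  · have := h.dist_eq_of_ne hT hx hr hrt
    omega

/-- If the sensor `t` is needed to tell `x` from the vertex `y`, which is farther from `t`, and `x`
is not in the branch of `t`, then `x` is measured by no sensors other than `s` and `t`. -/
theorem lt_dist_of_eq (h : Removable T S u t c s) (hT : T.IsTree) {x y : V}
    (hx : T.dist t x = T.dist t u + T.dist u x)
    (hxy : ∀ r ∈ S, r ≠ t → min (T.dist r x) (k + 1) = min (T.dist r y) (k + 1))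
    (hlt : min (T.dist t x) (k + 1) < min (T.dist t y) (k + 1))
    (hsx : T.dist s x ≤ k) {r : V} (hr : r ∈ S) (hrt : r ≠ t) (hrs : r ≠ s) : k < T.dist r x := by
  classical
  have hc := hT.connected
  have hu : T.dist u x < T.dist u y := by
    have := hc.dist_triangle (u := t) (v := u) (w := y)
    omega
  -- Since `y` is farther from `u` than `x`, a sensor measuring `x` and reaching `y` through `u`
  -- would tell them apart.
  have key : ∀ r ∈ S, r ≠ t → T.dist r x ≤ k → T.dist r y ≠ T.dist r u + T.dist u y := by
    intro r hr hrt hrx hry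
    have := hxy r hr hrt
    have := hc.dist_triangle (u := r) (v := u) (w := x)
    omega
  -- `u` lies between `r` and `c`, so one of the two reaches `y` through `u`.
  have pair : ∀ r ∈ S, r ≠ t → T.dist r x ≤ k → r ≠ c → c ≠ t → T.dist c x ≤ k → False := by
    intro r hr hrt hrx hrc hct hcx
    have := h.sep_c r hr hrc
    rcases between_or hT this y with h1 | h1
    · exact key r hr hrt hrx h1
    · exact key c h.mem_c hct hcx h1
  by_contra hrx
  rw [not_lt] at hrx
  by_cases hsc : s = c
  · exact pair r hr hrt hrx (hsc ▸ hrs) h.c_ne (hsc ▸ hsx)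
  -- Here `c` measures `x` too, being no farther from `u` than `t`, which reaches `x` through `u`.
  · refine pair s h.mem_s h.s_ne hsx hsc h.c_ne ?_
    have := hc.dist_triangle (u := c) (v := u) (w := x)
    have := h.c_le
    have e1 := T.dist_comm (u := c) (v := u)
    have e2 := T.dist_comm (u := t) (v := u)
    omega

end Removable

end Separation

/-! ### Counting signatures by removing one sensor at a time -/

section Counting

variable {V : Type*} [DecidableEq V] {T : SimpleGraph V}

/-- The vector of truncated distances of `x` from the sensors in `S`, extended by the value `k + 1`
for vertices which are not sensors. -/
noncomputable def signature (T : SimpleGraph V) (k : ℕ) (S : Finset V) (x : V) : V → ℕ :=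
  fun s => if s ∈ S then min (T.dist s x) (k + 1) else k + 1

theorem signature_apply {k : ℕ} {S : Finset V} {s : V} (hs : s ∈ S) (x : V) :
    signature T k S x s = min (T.dist s x) (k + 1) := if_pos hs

/-- The default value `k + 1` makes dropping a sensor the same as overwriting its coordinate, so
signatures for different sensor sets are directly comparable. -/
theorem update_signature (k : ℕ) (S : Finset V) (t x : V) :
    Function.update (signature T k S x) t (k + 1) = signature T k (S.erase t) x := by
  ext s
  by_cases hs : s = t
  · subst hs
    simp [signature]
  · simp [signature, hs]

variable [Fintype V]

/-- The signatures of the vertices which are measured by some sensor. -/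
noncomputable def signatures (T : SimpleGraph V) (k : ℕ) (S : Finset V) : Finset (V → ℕ) :=
  (Finset.univ.image (signature T k S)).filter fun ω => ∃ s, ω s ≤ k

theorem mem_signatures {k : ℕ} {S : Finset V} {ω : V → ℕ} :
    ω ∈ signatures T k S ↔ ∃ x, signature T k S x = ω ∧ ∃ s ∈ S, T.dist s x ≤ k := by
  simp only [signatures, Finset.mem_filter, Finset.mem_image, Finset.mem_univ, true_and]
  constructor
  · rintro ⟨⟨x, rfl⟩, s, hs⟩
    refine ⟨x, rfl, s, ?_⟩
    unfold signature at hs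
    split_ifs at hs with h
    · exact ⟨h, by omega⟩
    · omega
  · rintro ⟨x, rfl, s, hs, h⟩
    refine ⟨⟨x, rfl⟩, s, ?_⟩
    simp [signature, hs, h]

theorem card_signatures_singleton (k : ℕ) (s : V) : (signatures T k {s}).card ≤ k + 1 := by
  have := Finset.card_le_card_of_injOn (s := signatures T k {s}) (t := Finset.range (k + 1))
    (fun ω => ω s) ?_ ?_
  · simpa using this
  · intro ω hω
    obtain ⟨x, rfl, r, hr, h⟩ := mem_signatures.1 hω
    obtain rfl := Finset.mem_singleton.1 hr
    simpa [signature] using Nat.lt_succ_of_le h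
  · intro ω hω ω' hω' h
    obtain ⟨x, rfl, -⟩ := mem_signatures.1 hω
    obtain ⟨x', rfl, -⟩ := mem_signatures.1 hω'
    ext r
    by_cases hr : r = s
    · rw [hr]
      exact h
    · simp [signature, hr]

/-- Among signatures agreeing off `t`, only one has the largest value at `t`. Forgetting that value
is therefore injective on these signatures, and some remaining sensor still measures the vertex. -/
theorem card_maximal_signatures_le (T : SimpleGraph V) (k : ℕ) (S : Finset V) (t : V) :
    ((signatures T k S).filter fun ω => (¬ ∀ r, r ≠ t → ω r = k + 1) ∧
      ∀ ω' ∈ signatures T k S, (∀ r, r ≠ t → ω' r = ω r) → ω' t ≤ ω t).card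
      ≤ (signatures T k (S.erase t)).card := by
  refine Finset.card_le_card_of_injOn (fun ω => Function.update ω t (k + 1)) ?_ ?_
  · intro ω hω
    obtain ⟨hω, hr, -⟩ := Finset.mem_filter.1 hω
    obtain ⟨x, rfl, -⟩ := mem_signatures.1 hω
    push Not at hr
    obtain ⟨r, hrt, hr⟩ := hr
    simp only [update_signature]
    refine mem_signatures.2 ⟨x, rfl, r, ?_⟩
    unfold signature at hr
    split_ifs at hr with hrS
    · exact ⟨Finset.mem_erase.2 ⟨hrt, hrS⟩, by omega⟩
    · exact absurd rfl hr
  · intro ω hω ω' hω' heq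
    obtain ⟨hω, -, hm⟩ := Finset.mem_filter.1 hω
    obtain ⟨hω', -, hm'⟩ := Finset.mem_filter.1 hω'
    have hag : ∀ r, r ≠ t → ω' r = ω r := fun r hr => by
      have := congrFun heq r
      simpa [hr] using this.symm
    ext r
    by_cases hr : r = t
    · rw [hr]
      exact le_antisymm (hm' ω hω fun r hr => (hag r hr).symm) (hm ω' hω' hag)
    · exact (hag r hr).symm

namespace Removable

variable {S : Finset V} {u t c s : V} {k : ℕ}

/-- A vertex measured by `t` alone is farther than `k` from `s`, so by the triangle inequality its
distance to `t` is at least `k + 1 - d(s,t)`; this distance is its whole signature. -/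
theorem card_measured_only_le (h : Removable T S u t c s) (hT : T.IsTree) :
    ((signatures T k S).filter fun ω => ∀ r, r ≠ t → ω r = k + 1).card
      ≤ min (T.dist s t) (k + 1) := by
  have := Finset.card_le_card_of_injOn
    (s := (signatures T k S).filter fun ω => ∀ r, r ≠ t → ω r = k + 1)
    (t := Finset.Icc (k + 1 - T.dist s t) k) (fun ω => ω t) ?_ ?_
  · rw [Nat.card_Icc] at this
    omega
  · intro ω hω
    obtain ⟨hω, hr⟩ := Finset.mem_filter.1 hω
    obtain ⟨x, rfl, r, hrS, h1⟩ := mem_signatures.1 hω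
    have hrt : r = t := by
      by_contra hne
      have := hr r hne
      rw [signature_apply hrS] at this
      omega
    subst hrt
    have h2 := hr s h.s_ne
    rw [signature_apply h.mem_s] at h2
    have := hT.connected.dist_triangle (u := s) (v := r) (w := x)
    simp only [Finset.coe_Icc, Set.mem_Icc, signature_apply hrS]
    omega
  · intro ω hω ω' hω' heq
    obtain ⟨-, h1⟩ := Finset.mem_filter.1 hω
    obtain ⟨-, h2⟩ := Finset.mem_filter.1 hω'
    ext r
    by_cases hr : r = t
    · rw [hr]
      exact heq
    · rw [h1 r hr, h2 r hr]

/-- Such a vertex is measured by both `s` and `t`, and its two distances determine all other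
coordinates. -/
theorem card_not_maximal_le (h : Removable T S u t c s) (hT : T.IsTree) :
    ((signatures T k S).filter fun ω => (¬ ∀ r, r ≠ t → ω r = k + 1) ∧
      ¬ ∀ ω' ∈ signatures T k S, (∀ r, r ≠ t → ω' r = ω r) → ω' t ≤ ω t).card
      ≤ (valuePairs k (T.dist s t)).card := by
  have hc := hT.connected
  have key : ∀ ω ∈ (signatures T k S).filter fun ω => (¬ ∀ r, r ≠ t → ω r = k + 1) ∧
      ¬ ∀ ω' ∈ signatures T k S, (∀ r, r ≠ t → ω' r = ω r) → ω' t ≤ ω t,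
      ∃ x, signature T k S x = ω ∧ T.dist s x ≤ k ∧ T.dist t x ≤ k ∧
        T.dist t x < T.dist s x + T.dist s t ∧
        (T.dist t x = T.dist t u + T.dist u x → ∀ r ∈ S, r ≠ t → r ≠ s → k < T.dist r x) := by
    intro ω hω
    obtain ⟨hω, hr, hm⟩ := Finset.mem_filter.1 hω
    obtain ⟨x, rfl, -⟩ := mem_signatures.1 hω
    push Not at hr hm
    obtain ⟨r, hrt, hr⟩ := hr
    obtain ⟨ω', hω', hag, hlt⟩ := hm
    obtain ⟨y, rfl, -⟩ := mem_signatures.1 hω'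
    rw [signature_apply h.mem_t, signature_apply h.mem_t] at hlt
    have hxy : ∀ r ∈ S, r ≠ t → min (T.dist r x) (k + 1) = min (T.dist r y) (k + 1) := by
      intro r hrS hrt
      have := hag r hrt
      rw [signature_apply hrS, signature_apply hrS] at this
      exact this.symm
    have hrS : r ∈ S := by
      by_contra hrS
      exact hr (if_neg hrS)
    rw [signature_apply hrS] at hr
    have htx : T.dist t x ≤ k := by omega
    have hsx := h.dist_s_le hT hrS hrt (by omega) htx
    refine ⟨x, rfl, hsx, htx, ?_, fun hx r hrS hrt hrs =>
      h.lt_dist_of_eq hT hx hxy hlt hsx hrS hrt hrs⟩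
    -- The value at `t` is beaten by that of `y`, where it is at most `d(t,s) + d(s,y)` with `d(s,y)
    -- = d(s,x)`. Hence the strict inequality in `valuePairs`.
    have h1 := hxy s h.mem_s h.s_ne
    have h2 := hc.dist_triangle (u := t) (v := s) (w := y)
    have h3 := T.dist_comm (u := t) (v := s)
    omega
  refine Finset.card_le_card_of_injOn (fun ω => (ω s, ω t)) ?_ ?_
  · intro ω hω
    obtain ⟨x, rfl, hsx, htx, hlt, -⟩ := key ω hω
    have h1 := hc.dist_triangle (u := s) (v := x) (w := t)
    have h2 := hc.dist_triangle (u := s) (v := t) (w := x)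
    have h3 := dist_parity hT s t x
    have h4 := T.dist_comm (u := x) (v := t)
    simp only [valuePairs, Finset.coe_filter, Set.mem_ofPred_eq, Finset.mem_product,
      Finset.mem_range, signature_apply h.mem_s, signature_apply h.mem_t]
    omega
  · intro ω hω ω' hω' heq
    obtain ⟨x, rfl, hsx, htx, -, hx⟩ := key ω hω
    obtain ⟨y, rfl, hsy, hty, -, hy⟩ := key ω' hω'
    simp only [signature_apply h.mem_s, signature_apply h.mem_t, Prod.mk.injEq] at heq
    have hs : T.dist s x = T.dist s y := by omega
    have ht : T.dist t x = T.dist t y := by omega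
    have tx := hc.dist_triangle (u := t) (v := u) (w := x)
    have ty := hc.dist_triangle (u := t) (v := u) (w := y)
    have sx := hc.dist_triangle (u := s) (v := u) (w := x)
    have sy := hc.dist_triangle (u := s) (v := u) (w := y)
    have hd : ∀ r ∈ S, min (T.dist r x) (k + 1) = min (T.dist r y) (k + 1) := by
      intro r hr
      by_cases hrt : r = t
      · rw [hrt, ht]
      by_cases hrs : r = s
      · rw [hrs, hs]
      -- If `t` reaches both vertices through `u`, all other sensors show `k + 1`. If it reaches
      -- neither so, the distance to `s` fixes the distance to `u` and with it all others. The mixed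
      -- cases contradict equality of the two values.
      by_cases hxu : T.dist t x = T.dist t u + T.dist u x
      · by_cases hyu : T.dist t y = T.dist t u + T.dist u y
        · have := hx hxu r hr hrt hrs
          have := hy hyu r hr hrt hrs
          omega
        · have := h.dist_eq_of_ne hT hyu h.mem_s h.s_ne
          omega
      · have h1 := h.dist_eq_of_ne hT hxu h.mem_s h.s_ne
        by_cases hyu : T.dist t y = T.dist t u + T.dist u y
        · omega
        · have h2 := h.dist_eq_of_ne hT hyu h.mem_s h.s_ne
          have h3 := h.dist_eq_of_ne hT hxu hr hrt
          have h4 := h.dist_eq_of_ne hT hyu hr hrt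
          omega
    ext r
    by_cases hr : r ∈ S
    · rw [signature_apply hr, signature_apply hr, hd r hr]
    · simp [signature, hr]

theorem three_mul_card_signatures_le (h : Removable T S u t c s) (hT : T.IsTree) (hk : 1 ≤ k) :
    3 * (signatures T k S).card ≤ 3 * (signatures T k (S.erase t)).card + gain k := by
  have h1 := h.card_measured_only_le (k := k) hT
  have h2 := card_maximal_signatures_le T k S t
  have h3 := h.card_not_maximal_le (k := k) hT
  have h4 := card_valuePairs_le k (T.dist s t)
  have h5 := three_mul_positionCount_le (k := k) (D := T.dist s t) hk
  have e1 := Finset.card_filter_add_card_filter_not (s := signatures T k S)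
    (fun ω => ∀ r, r ≠ t → ω r = k + 1)
  have e2 := Finset.card_filter_add_card_filter_not
    (s := (signatures T k S).filter fun ω => ¬ ∀ r, r ≠ t → ω r = k + 1)
    (fun ω => ∀ ω' ∈ signatures T k S, (∀ r, r ≠ t → ω' r = ω r) → ω' t ≤ ω t)
  rw [Finset.filter_filter, Finset.filter_filter] at e2
  omega

end Removable

theorem three_mul_card_signatures_le (hT : T.IsTree) {k : ℕ} (hk : 1 ≤ k) (m : ℕ) :
    ∀ S : Finset V, S.card = m + 1 →
      3 * (signatures T k S).card ≤ 3 * (k + 1) + m * gain k := by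
  induction m with
  | zero =>
    intro S hS
    obtain ⟨s, rfl⟩ := Finset.card_eq_one.1 hS
    have := card_signatures_singleton (T := T) k s
    omega
  | succ m ih =>
    intro S hS
    obtain ⟨u, t, c, s, h⟩ := exists_removable hT (S := S) (by omega)
    have h1 := h.three_mul_card_signatures_le hT hk
    have h2 := ih (S.erase t) (by rw [Finset.card_erase_of_mem h.mem_t]; omega)
    rw [Nat.add_mul, one_mul]
    omega

end Counting

/-! ### Resolving positions on a line -/

section Line

/-- The sensors at the positions in `A` measure and tell apart all positions `i` with
`x < i ≤ l` on a line. -/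
def ResolvesIoc (k : ℕ) (A : Finset ℕ) (x l : ℕ) : Prop :=
  (∀ i, x < i → i ≤ l → ∃ a ∈ A, (i - a : ℤ).natAbs ≤ k) ∧
    ∀ i j, x < i → i < j → j ≤ l →
      ∃ a ∈ A, min (i - a : ℤ).natAbs (k + 1) ≠ min (j - a : ℤ).natAbs (k + 1)

/-- A sensor that measures no position of the smaller interval reads `k + 1` on all of it and can be
dropped. -/
theorem ResolvesIoc.mono {k x l x' l' : ℕ} {A A' : Finset ℕ} (h : ResolvesIoc k A x l)
    (hx : x ≤ x') (hl : l' ≤ l)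
    (hA : ∀ a ∈ A, a ∉ A' → ∀ i : ℕ, x' < i → i ≤ l' → k < (i - a : ℤ).natAbs) :
    ResolvesIoc k A' x' l' := by
  refine ⟨fun i h1 h2 => ?_, fun i j h1 h2 h3 => ?_⟩
  · obtain ⟨a, ha, hi⟩ := h.1 i (by omega) (by omega)
    refine ⟨a, ?_, hi⟩
    by_contra ha'
    exact absurd (hA a ha ha' i h1 h2) (by omega)
  · obtain ⟨a, ha, hij⟩ := h.2 i j (by omega) h2 (by omega)
    refine ⟨a, ?_, hij⟩
    by_contra ha'
    have := hA a ha ha' i h1 (by omega)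
    have := hA a ha ha' j (by omega) h3
    omega

/-- The largest number of consecutive positions on a line that `m` sensors resolve. -/
def lineCapacity (k m : ℕ) : ℕ := m / 2 * (3 * k + 2) + m % 2 * (k + 1)

theorem ResolvesIoc.sub_le_of_singleton {k a x l : ℕ} (h : ResolvesIoc k {a} x l) :
    l - x ≤ k + 1 := by
  have := Finset.card_le_card_of_injOn (s := Finset.Ioc x l) (t := Finset.range (k + 1))
    (fun i => (i - a : ℤ).natAbs) ?_ ?_
  · simpa using this
  · intro i hi
    obtain ⟨h1, h2⟩ := Finset.mem_Ioc.1 hi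
    obtain ⟨b, hb, hi⟩ := h.1 i h1 h2
    obtain rfl := Finset.mem_singleton.1 hb
    simp only [Finset.coe_range, Set.mem_Iio]
    omega
  · intro i hi j hj hij
    obtain ⟨h1, h2⟩ := Finset.mem_Ioc.1 hi
    obtain ⟨h3, h4⟩ := Finset.mem_Ioc.1 hj
    simp only at hij
    rcases lt_trichotomy i j with hlt | heq | hlt
    · obtain ⟨b, hb, h⟩ := h.2 i j h1 hlt h4
      rw [Finset.mem_singleton.1 hb, hij] at h
      exact absurd rfl h
    · exact heq
    · obtain ⟨b, hb, h⟩ := h.2 j i h3 hlt h2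
      rw [Finset.mem_singleton.1 hb, hij] at h
      exact absurd rfl h

/-- Induction removing the two leftmost sensors `a < b`: neither measures anything beyond `b + k`,
and at most `3k + 2` positions lie up to there. -/
theorem ResolvesIoc.sub_le_lineCapacity {k : ℕ} (m : ℕ) : ∀ {A : Finset ℕ} {x l : ℕ},
    A.card = m → ResolvesIoc k A x l → l - x ≤ lineCapacity k m := by
  induction m using Nat.strong_induction_on with
  | _ m ih =>
  intro A x l hA h
  rcases le_or_gt l x with hlx | hlx
  · omega
  obtain ⟨a', ha', hx⟩ := h.1 (x + 1) (by omega) (by omega)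
  have hne : A.Nonempty := ⟨a', ha'⟩
  obtain ⟨a, ha, hmin⟩ := Finset.exists_min_image A id hne
  simp only [id] at hmin
  have hxa := hmin a' ha'
  obtain rfl | hm : m = 1 ∨ 2 ≤ m := by
    have := hne.card_pos
    omega
  · obtain ⟨b, rfl⟩ := Finset.card_eq_one.1 hA
    simpa [lineCapacity] using h.sub_le_of_singleton
  have hcard := Finset.card_erase_of_mem ha
  obtain ⟨b, hb, hmin'⟩ := Finset.exists_min_image (A.erase a) id
    (Finset.card_pos.1 (by omega))
  simp only [id] at hmin'
  have hcard' := Finset.card_erase_of_mem hb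
  have hab := hmin b (Finset.mem_of_mem_erase hb)
  have hrest : l - max x (b + k) ≤ lineCapacity k (m - 2) := by
    refine ih (m - 2) (by omega) (A := (A.erase a).erase b) (by omega)
      (h.mono (le_max_left _ _) le_rfl fun c hc hc' i hi _ => ?_)
    have : c = b ∨ c = a := by
      by_contra! hcc
      exact hc' (Finset.mem_erase.2 ⟨hcc.1, Finset.mem_erase.2 ⟨hcc.2, hc⟩⟩)
    rcases this with rfl | rfl <;> omega
  have hstrip : min l (b + k) - x ≤ 3 * k + 2 := by
    -- If `b` is near `a`, all positions lie between `a - k` and `b + k ≤ a + 2k + 1`. Otherwise `a`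
    -- alone handles those before `b - k`, at most `k + 1`, and `2k + 1` more are within reach of
    -- `b`.
    rcases le_or_gt b (a + k + 1) with hle | hgt
    · push_cast at hx
      omega
    · have := (h.mono (A' := {a}) (x' := x) (l' := min l (b - k - 1)) le_rfl (min_le_left _ _)
        fun c hc hc' i _ hi => by
          have := hmin' c (Finset.mem_erase.2 ⟨fun h => hc' (Finset.mem_singleton.2 h), hc⟩)
          omega).sub_le_of_singleton
      omega
  have hcap : lineCapacity k m = 3 * k + 2 + lineCapacity k (m - 2) := by
    unfold lineCapacity
    rw [show m / 2 = (m - 2) / 2 + 1 by omega, show m % 2 = (m - 2) % 2 by omega]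
    ring
  omega

theorem ResolvesIoc.lowerComplexity_le {k l : ℕ} {A : Finset ℕ} (h : ResolvesIoc k A k l) :
    lowerComplexity k l ≤ A.card := by
  have hl := h.sub_le_lineCapacity A.card rfl
  unfold lineCapacity at hl
  unfold lowerComplexity
  have hdiv := Nat.div_add_mod l (3 * k + 2)
  have hr := Nat.mod_lt l (show 0 < 3 * k + 2 by omega)
  generalize l / (3 * k + 2) = q at *
  generalize l % (3 * k + 2) = r at *
  have hm := Nat.div_add_mod A.card 2
  have he : A.card % 2 = 0 ∨ A.card % 2 = 1 := by omega
  generalize A.card % 2 = e at *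
  generalize A.card / 2 = p at *
  rcases lt_trichotomy q p with hqp | rfl | hqp
  · split_ifs <;> omega
  · have := Nat.mul_comm q (3 * k + 2)
    rcases he with rfl | rfl <;> split_ifs <;> omega
  · have := Nat.mul_le_mul_left (3 * k + 2) hqp
    rw [Nat.mul_succ, Nat.mul_comm _ p] at this
    rcases he with rfl | rfl <;> omega

/-- The sensor `a` measures nothing beyond `a + k ≤ 2k + 1`, so the other sensors resolve the rest,
and `l` is at most `2k + 1` plus the capacity of one sensor fewer. -/
theorem ResolvesIoc.upperComplexity_le {k l a : ℕ} {A : Finset ℕ} (h : ResolvesIoc k A k l)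
    (ha : a ∈ A) (hak : a ≤ k + 1) : upperComplexity k l ≤ A.card := by
  have hcard := Finset.card_erase_add_one ha
  have hl := (h.mono (A' := A.erase a) (x' := a + k) (l' := l) (by omega) le_rfl
    fun c hc hc' i hi _ => by
      have : c = a := by
        by_contra hca
        exact hc' (Finset.mem_erase.2 ⟨hca, hc⟩)
      omega).sub_le_lineCapacity _ rfl
  unfold lineCapacity at hl
  unfold upperComplexity
  have hdiv := Nat.div_add_mod l (3 * k + 2)
  have hr := Nat.mod_lt l (show 0 < 3 * k + 2 by omega)
  generalize l / (3 * k + 2) = q at *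
  generalize l % (3 * k + 2) = r at *
  generalize (A.erase a).card = m at *
  have hm := Nat.div_add_mod m 2
  have he : m % 2 = 0 ∨ m % 2 = 1 := by omega
  generalize m % 2 = e at *
  generalize m / 2 = p at *
  obtain hqp | rfl | rfl | hqp : q < p ∨ q = p ∨ q = p + 1 ∨ p + 2 ≤ q := by omega
  · split_ifs <;> omega
  · have := Nat.mul_comm q (3 * k + 2)
    rcases he with rfl | rfl <;> split_ifs <;> omega
  · rw [Nat.mul_succ, Nat.mul_comm _ p] at hdiv
    rcases he with rfl | rfl <;> split_ifs <;> omega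
  · have := Nat.mul_le_mul_left (3 * k + 2) hqp
    rw [Nat.mul_add, Nat.mul_comm _ p] at this
    rcases he with rfl | rfl <;> omega

end Line

/-! ### Leaf-paths and the sensors they require -/

section LeafPathGeometry

variable {V : Type*} {T : SimpleGraph V}

theorem dist_getVert_add_le (hc : T.Connected) {v w : V} (p : T.Walk v w) (i n : ℕ)
    (h : i + n ≤ p.length) : T.dist (p.getVert i) (p.getVert (i + n)) ≤ n := by
  induction n with
  | zero => simp
  | succ n ih =>
    have h1 := ih (by omega)
    have h2 := SimpleGraph.dist_eq_one_iff_adj.2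
      (p.adj_getVert_succ (i := i + n) (by omega))
    have h3 := hc.dist_triangle (u := p.getVert i) (v := p.getVert (i + n))
      (w := p.getVert (i + n + 1))
    rw [← add_assoc]
    omega

theorem dist_getVert (hT : T.IsTree) {v w : V} {p : T.Walk v w} (hp : p.IsPath) {i j : ℕ}
    (hi : i ≤ p.length) (hj : j ≤ p.length) :
    T.dist (p.getVert i) (p.getVert j) = (i - j : ℤ).natAbs := by
  have hc := hT.connected
  wlog hij : i ≤ j generalizing i j
  · rw [T.dist_comm, this hj hi (by omega)]
    omega
  -- The bounds for the three segments of the path add up to its length, which is the distance of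
  -- its ends, so all are equalities.
  have h0 := length_eq_dist_of_isPath hT hp
  have h1 := dist_getVert_add_le hc p 0 i (by omega)
  have h2 := dist_getVert_add_le hc p i (j - i) (by omega)
  have h3 := dist_getVert_add_le hc p j (p.length - j) (by omega)
  rw [zero_add, p.getVert_zero] at h1
  rw [show i + (j - i) = j by omega] at h2
  rw [show j + (p.length - j) = p.length by omega, p.getVert_length] at h3
  have t1 := hc.dist_triangle (u := v) (v := p.getVert i) (w := w)
  have t2 := hc.dist_triangle (u := p.getVert i) (v := p.getVert j) (w := w)
  omega

theorem truncDist_eq (hc : T.Connected) (k : ℕ) (x y : V) :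
    truncDist T k x y = ((min (T.dist x y) (k + 1) : ℕ) : ℕ∞) := by
  rw [truncDist, ← (hc x y).coe_dist_eq_edist]
  rfl

theorem isThresholdResolving_iff (hc : T.Connected) {k : ℕ} {S : Finset V} :
    IsThresholdResolving T k S ↔
      (∀ x y, x ≠ y → ∃ s ∈ S, min (T.dist s x) (k + 1) ≠ min (T.dist s y) (k + 1)) ∧
        ∀ x, ∃ s ∈ S, T.dist s x ≤ k := by
  simp only [IsThresholdResolving, truncDist_eq hc, ne_eq, Nat.cast_inj, Nat.cast_le]
  refine and_congr_right fun _ => forall_congr' fun x => exists_congr fun s => ?_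
  refine and_congr_right fun _ => ?_
  omega

section PathTail

variable [DecidableEq V]

/-- The vertices of a path other than its starting point. -/
def pathTail {v : V} (P : Σ w : V, T.Path v w) : Finset V := P.2.1.support.toFinset.erase v

theorem mem_pathTail {v x : V} {P : Σ w : V, T.Path v w} :
    x ∈ pathTail P ↔ x ≠ v ∧ x ∈ P.2.1.support := by
  simp [pathTail]

theorem mem_pathTail_iff_exists {v x : V} {P : Σ w : V, T.Path v w} :
    x ∈ pathTail P ↔ ∃ i, 1 ≤ i ∧ i ≤ pathLength T P ∧ P.2.1.getVert i = x := by
  rw [mem_pathTail, SimpleGraph.Walk.mem_support_iff_exists_getVert]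
  constructor
  · rintro ⟨hx, i, rfl, hi⟩
    refine ⟨i, Nat.one_le_iff_ne_zero.2 ?_, hi, rfl⟩
    rintro rfl
    exact hx P.2.1.getVert_zero
  · rintro ⟨i, h1, hi, rfl⟩
    refine ⟨fun h => ?_, i, rfl, hi⟩
    have := (P.2.2.getVert_eq_start_iff hi).1 h
    omega

theorem card_pathTail {v : V} (P : Σ w : V, T.Path v w) :
    (pathTail P).card = pathLength T P := by
  rw [pathTail, Finset.card_erase_of_mem (by simp),
    List.toFinset_card_of_nodup P.2.2.support_nodup, SimpleGraph.Walk.length_support]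
  rfl

theorem eq_of_notMem_pathTail {v x : V} {P : Σ w : V, T.Path v w} (hx : x ∉ pathTail P)
    (hs : x ∈ P.2.1.support) : x = v := by
  by_contra hne
  exact hx (mem_pathTail.2 ⟨hne, hs⟩)

/-- The positions of the sensors on a path, without its starting point. -/
def sensorPositions (S : Finset V) {v : V} (P : Σ w : V, T.Path v w) : Finset ℕ :=
  (Finset.Icc 1 (pathLength T P)).filter fun i => P.2.1.getVert i ∈ S

theorem card_sensorPositions (S : Finset V) {v : V} (P : Σ w : V, T.Path v w) :
    (sensorPositions S P).card = (S ∩ pathTail P).card := by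
  refine Finset.card_bij (fun i _ => P.2.1.getVert i) ?_ ?_ ?_
  · intro i hi
    obtain ⟨hi, hS⟩ := Finset.mem_filter.1 hi
    obtain ⟨h1, h2⟩ := Finset.mem_Icc.1 hi
    exact Finset.mem_inter.2 ⟨hS, mem_pathTail_iff_exists.2 ⟨i, h1, h2, rfl⟩⟩
  · intro i hi j hj hij
    exact P.2.2.getVert_injOn (Finset.mem_Icc.1 (Finset.mem_filter.1 hi).1).2
      (Finset.mem_Icc.1 (Finset.mem_filter.1 hj).1).2 hij
  · intro x hx
    obtain ⟨hS, hx⟩ := Finset.mem_inter.1 hx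
    obtain ⟨i, h1, h2, rfl⟩ := mem_pathTail_iff_exists.1 hx
    exact ⟨i, Finset.mem_filter.2 ⟨Finset.mem_Icc.2 ⟨h1, h2⟩, hS⟩, rfl⟩

end PathTail

variable [Fintype V] [DecidableRel T.Adj]

theorem IsLeafPath.length_pos {v w : V} {p : T.Walk v w} (h : IsLeafPath T p) : 0 < p.length := by
  obtain ⟨-, -, hv, hw, -⟩ := h
  cases p with
  | nil => omega
  | cons => simp

variable [DecidableEq V]

namespace IsLeafPath

variable {v w : V} {p : T.Walk v w}

theorem degree_le_two (h : IsLeafPath T p) {x : V} (hx : x ∈ p.support) (hxv : x ≠ v) :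
    T.degree x ≤ 2 := by
  obtain ⟨-, -, -, hw, h2⟩ := h
  by_cases hxw : x = w
  · subst hxw
    omega
  · exact (h2 x hx hxv hxw).le

/-- The neighbours of `x` along the path already exhaust its degree. -/
theorem mem_support_of_adj (h : IsLeafPath T p) {x y : V} (hx : x ∈ p.support) (hxv : x ≠ v)
    (hxy : T.Adj x y) : y ∈ p.support := by
  obtain ⟨hp, -, hv, hw, h2⟩ := h
  obtain ⟨i, rfl, hi⟩ := SimpleGraph.Walk.mem_support_iff_exists_getVert.1 hx
  have hi0 : i ≠ 0 := by
    rintro rfl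
    exact hxv p.getVert_zero
  have hprev : T.Adj (p.getVert i) (p.getVert (i - 1)) := by
    have := p.adj_getVert_succ (i := i - 1) (by omega)
    rw [show i - 1 + 1 = i by omega] at this
    exact this.symm
  suffices ∃ N : Finset V, N ⊆ T.neighborFinset (p.getVert i) ∧
      T.degree (p.getVert i) ≤ N.card ∧ ∀ z ∈ N, z ∈ p.support by
    obtain ⟨N, hN, hcard, hsup⟩ := this
    refine hsup y ?_
    rw [Finset.eq_of_subset_of_card_le hN hcard]
    exact (T.mem_neighborFinset _ _).2 hxy
  rcases hi.eq_or_lt with rfl | hlt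
  · refine ⟨{p.getVert (p.length - 1)}, ?_, ?_, ?_⟩
    · simpa using hprev
    · rw [p.getVert_length, hw, Finset.card_singleton]
    · simp [p.getVert_mem_support]
  · have hne : p.getVert (i - 1) ≠ p.getVert (i + 1) := fun he => by
      have := hp.getVert_injOn (by simp; omega) (by simp; omega) he
      omega
    refine ⟨{p.getVert (i - 1), p.getVert (i + 1)}, ?_, ?_, ?_⟩
    · intro z hz
      rw [T.mem_neighborFinset]
      rcases Finset.mem_insert.1 hz with rfl | hz
      · exact hprev
      · rw [Finset.mem_singleton.1 hz]
        exact p.adj_getVert_succ hlt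
    · rw [Finset.card_pair hne, h2 _ hx hxv]
      exact fun he => by
        have := (hp.getVert_eq_end_iff hi).1 he
        omega
    · intro z hz
      rcases Finset.mem_insert.1 hz with rfl | hz
      · exact p.getVert_mem_support _
      · rw [Finset.mem_singleton.1 hz]
        exact p.getVert_mem_support _

/-- Only `v` has neighbours off the path, so a walk can leave only through `v`. -/
theorem mem_support_of_exit (h : IsLeafPath T p) {x s : V} (q : T.Walk x s) :
    x ∈ p.support → (s ∈ p.support → s = v) → v ∈ q.support := by
  induction q with
  | nil =>
    intro hx hs
    simp [hs hx]
  | @cons a b c hab q ih =>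
    intro hx hs
    by_cases hav : a = v
    · simp [hav]
    · rw [SimpleGraph.Walk.support_cons]
      exact List.mem_cons_of_mem _ (ih (h.mem_support_of_adj hx hav hab) hs)

theorem dist_eq_add (h : IsLeafPath T p) (hT : T.IsTree) {x s : V} (hx : x ∈ p.support)
    (hs : s ∈ p.support → s = v) : T.dist s x = T.dist s v + T.dist v x := by
  obtain ⟨q, hq⟩ := hT.connected.exists_walk_length_eq_dist x s
  have := dist_eq_add_of_mem_support hT.connected hq (h.mem_support_of_exit q hx hs)
  rw [T.dist_comm, this, T.dist_comm (u := x), T.dist_comm (u := v) (v := s), add_comm]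

theorem dist_getVert_of_notMem (h : IsLeafPath T p) (hT : T.IsTree) {s : V}
    (hs : s ∈ p.support → s = v) {i : ℕ} (hi : i ≤ p.length) :
    T.dist s (p.getVert i) = T.dist s v + i := by
  rw [h.dist_eq_add hT (p.getVert_mem_support i) hs]
  have := dist_getVert hT h.1 (Nat.zero_le _) hi
  rw [p.getVert_zero] at this
  rw [this]
  omega

/-- Degrees keep each starting vertex out of the other path's tail. The leaf `w` lies on the tail of
`p'` and is thus its leaf; then each starting vertex is between the other one and `w`, which forces
them to coincide. -/
theorem eq_of_mem_support (hT : T.IsTree) {v' w' : V} {p' : T.Walk v' w'} (h : IsLeafPath T p)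
    (h' : IsLeafPath T p') {x : V} (hx : x ∈ p.support) (hxv : x ≠ v) (hx' : x ∈ p'.support)
    (hxv' : x ≠ v') : v = v' ∧ w = w' := by
  have hc := hT.connected
  have hv : v ∈ p'.support → v = v' := fun hm => by
    by_contra hne
    have := h'.degree_le_two hm hne
    have := h.2.2.1
    omega
  have hv' : v' ∈ p.support → v' = v := fun hm => by
    by_contra hne
    have := h.degree_le_two hm hne
    have := h'.2.2.1
    omega
  -- Otherwise `w` reaches `x` through `v'`, and `v'` reaches the path through `v`. This makes
  -- `d(w,x)` at least `d(w,v) + d(v,x)`, although `x ≠ v` lies between `v` and `w`.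
  have hw : w ∈ p'.support ∧ w ≠ v' := by
    by_contra hcon
    have hwp : w ∈ p'.support → w = v' := fun h1 => by
      by_contra h2
      exact hcon ⟨h1, h2⟩
    have e1 := h'.dist_eq_add hT hx' hwp
    have e2 := h.dist_eq_add hT hx hv'
    have e3 := h.dist_eq_add hT p.end_mem_support hv'
    obtain ⟨i, rfl, hi⟩ := SimpleGraph.Walk.mem_support_iff_exists_getVert.1 hx
    have hi0 : i ≠ 0 := by
      rintro rfl
      exact hxv p.getVert_zero
    have e4 := dist_getVert hT h.1 (Nat.zero_le _) hi
    have e5 := dist_getVert hT h.1 le_rfl hi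
    have e6 := dist_getVert hT h.1 (Nat.zero_le _) le_rfl
    rw [p.getVert_zero] at e4 e6
    rw [p.getVert_length] at e5 e6
    rw [T.dist_comm (u := w) (v := v')] at e1
    omega
  have hww : w = w' := by
    by_contra hne
    have := h'.2.2.2.2 w hw.1 hw.2 hne
    have := h.2.2.2.1
    omega
  refine ⟨?_, hww⟩
  have e1 := h'.dist_eq_add hT hw.1 hv
  have e2 := h.dist_eq_add hT p.end_mem_support hv'
  rw [T.dist_comm (u := v') (v := v)] at e2
  exact hc.dist_eq_zero_iff.1 (by omega)

end IsLeafPath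

theorem mem_leafPaths {v : V} {P : Σ w : V, T.Path v w} :
    P ∈ leafPaths T v ↔ IsLeafPath T P.2.1 := by
  simp [leafPaths]

theorem disjoint_pathTail (hT : T.IsTree) {X Y : Σ v : V, Σ w : V, T.Path v w}
    (hX : X.2 ∈ leafPaths T X.1) (hY : Y.2 ∈ leafPaths T Y.1) (hne : X ≠ Y) :
    Disjoint (pathTail X.2) (pathTail Y.2) := by
  rw [Finset.disjoint_left]
  intro x hx hy
  refine hne ?_
  obtain ⟨v, w, P⟩ := X
  obtain ⟨v', w', P'⟩ := Y
  rw [mem_pathTail] at hx hy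
  obtain ⟨rfl, rfl⟩ := (mem_leafPaths.1 hX).eq_of_mem_support hT (mem_leafPaths.1 hY) hx.2 hx.1
    hy.2 hy.1
  rw [(hT.isAcyclic.subsingleton_path v w).elim P P']

section Sensors

variable {k : ℕ} {S : Finset V} {v : V}

/-- A sensor off the tail is at distance at least `i` from the `i`-th vertex. Thus it measures none
with `i > k` and cannot tell two of them apart. -/
theorem resolvesIoc_sensorPositions (hT : T.IsTree) (hS : IsThresholdResolving T k S)
    {P : Σ w : V, T.Path v w} (hP : P ∈ leafPaths T v) :
    ResolvesIoc k (sensorPositions S P) k (pathLength T P) := by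
  have hL := mem_leafPaths.1 hP
  obtain ⟨hres, hmeas⟩ := (isThresholdResolving_iff hT.connected).1 hS
  refine ⟨fun i h1 h2 => ?_, fun i j h1 h2 h3 => ?_⟩
  · obtain ⟨s, hs, hd⟩ := hmeas (P.2.1.getVert i)
    by_cases hsP : s ∈ pathTail P
    · obtain ⟨a, ha1, ha2, rfl⟩ := mem_pathTail_iff_exists.1 hsP
      refine ⟨a, Finset.mem_filter.2 ⟨Finset.mem_Icc.2 ⟨ha1, ha2⟩, hs⟩, ?_⟩
      rw [dist_getVert hT hL.1 ha2 h2] at hd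
      omega
    · rw [hL.dist_getVert_of_notMem hT (eq_of_notMem_pathTail hsP) h2] at hd
      omega
  · obtain ⟨s, hs, hd⟩ := hres (P.2.1.getVert i) (P.2.1.getVert j) fun he => by
      have := P.2.2.getVert_injOn (show i ≤ _ from by unfold pathLength at h3; omega) h3 he
      omega
    have hi : i ≤ P.2.1.length := by unfold pathLength at h3; omega
    by_cases hsP : s ∈ pathTail P
    · obtain ⟨a, ha1, ha2, rfl⟩ := mem_pathTail_iff_exists.1 hsP
      refine ⟨a, Finset.mem_filter.2 ⟨Finset.mem_Icc.2 ⟨ha1, ha2⟩, hs⟩, ?_⟩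
      rw [dist_getVert hT hL.1 ha2 h3, dist_getVert hT hL.1 ha2 hi] at hd
      omega
    · rw [hL.dist_getVert_of_notMem hT (eq_of_notMem_pathTail hsP) h3,
        hL.dist_getVert_of_notMem hT (eq_of_notMem_pathTail hsP) hi] at hd
      omega

/-- Without sensors on the first `k + 1` vertices of a leaf-path, the sensors on this leaf-path do
not help to tell apart the first vertices of any two leaf-paths at `v`. -/
theorem lt_dist_getVert_one (hT : T.IsTree) {P Q : Σ w : V, T.Path v w} (hP : P ∈ leafPaths T v)
    (hQ : Q ∈ leafPaths T v) (hfar : ∀ a ∈ sensorPositions S P, k + 1 < a) {s : V} (hs : s ∈ S)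
    (hsP : s ∈ pathTail P) : k < T.dist s (Q.2.1.getVert 1) := by
  have hL := mem_leafPaths.1 hP
  have hM := mem_leafPaths.1 hQ
  obtain ⟨a, ha1, ha2, rfl⟩ := mem_pathTail_iff_exists.1 hsP
  have ha := hfar a (Finset.mem_filter.2 ⟨Finset.mem_Icc.2 ⟨ha1, ha2⟩, hs⟩)
  by_cases hPQ : P = Q
  · subst hPQ
    rw [dist_getVert hT hL.1 ha2 hL.length_pos]
    omega
  · have hdisj := disjoint_pathTail hT (X := ⟨v, P⟩) (Y := ⟨v, Q⟩) hP hQ (by simpa using hPQ)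
    rw [hM.dist_getVert_of_notMem hT
      (eq_of_notMem_pathTail (Finset.disjoint_left.1 hdisj hsP)) hM.length_pos]
    have := dist_getVert hT hL.1 ha2 (Nat.zero_le _)
    rw [P.2.1.getVert_zero] at this
    omega

/-- Two deficient paths at `v` would have no sensor among their first `k + 1` vertices. Their own
sensors then measure neither first vertex, and every other sensor is equally far from both. -/
theorem eq_of_card_lt_upperComplexity (hT : T.IsTree) (hS : IsThresholdResolving T k S)
    {P Q : Σ w : V, T.Path v w} (hP : P ∈ leafPaths T v) (hQ : Q ∈ leafPaths T v)
    (hPc : (S ∩ pathTail P).card < upperComplexity k (pathLength T P))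
    (hQc : (S ∩ pathTail Q).card < upperComplexity k (pathLength T Q)) : P = Q := by
  by_contra hne
  have far : ∀ R : Σ w : V, T.Path v w, R ∈ leafPaths T v →
      (S ∩ pathTail R).card < upperComplexity k (pathLength T R) →
      ∀ a ∈ sensorPositions S R, k + 1 < a := by
    intro R hR hRc a ha
    by_contra hak
    have := (resolvesIoc_sensorPositions hT hS hR).upperComplexity_le ha (not_lt.1 hak)
    rw [card_sensorPositions] at this
    omega
  have hL := mem_leafPaths.1 hP
  have hM := mem_leafPaths.1 hQ
  have hdisj := disjoint_pathTail hT (X := ⟨v, P⟩) (Y := ⟨v, Q⟩) hP hQ (by simpa using hne)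
  have hPm : P.2.1.getVert 1 ∈ pathTail P :=
    mem_pathTail_iff_exists.2 ⟨1, le_rfl, hL.length_pos, rfl⟩
  have hQm : Q.2.1.getVert 1 ∈ pathTail Q :=
    mem_pathTail_iff_exists.2 ⟨1, le_rfl, hM.length_pos, rfl⟩
  obtain ⟨s, hs, hd⟩ := ((isThresholdResolving_iff hT.connected).1 hS).1 (P.2.1.getVert 1)
    (Q.2.1.getVert 1) fun h => Finset.disjoint_left.1 hdisj hPm (h ▸ hQm)
  by_cases hsP : s ∈ pathTail P
  · have := lt_dist_getVert_one hT hP hP (far P hP hPc) hs hsP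
    have := lt_dist_getVert_one hT hP hQ (far P hP hPc) hs hsP
    omega
  by_cases hsQ : s ∈ pathTail Q
  · have := lt_dist_getVert_one hT hQ hP (far Q hQ hQc) hs hsQ
    have := lt_dist_getVert_one hT hQ hQ (far Q hQ hQc) hs hsQ
    omega
  rw [hL.dist_getVert_of_notMem hT (eq_of_notMem_pathTail hsP) hL.length_pos,
    hM.dist_getVert_of_notMem hT (eq_of_notMem_pathTail hsQ) hM.length_pos] at hd
  exact hd rfl

/-- At most one leaf-path is deficient. It saves at most the difference of its two complexities,
hence the single maximum in `leafPathSensors`. -/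
theorem leafPathSensors_le (hT : T.IsTree) (hS : IsThresholdResolving T k S) (v : V) :
    leafPathSensors T k v ≤ ∑ P ∈ leafPaths T v, ((S ∩ pathTail P).card : ℤ) := by
  have hlow : ∀ P ∈ leafPaths T v,
      lowerComplexity k (pathLength T P) ≤ (S ∩ pathTail P).card := fun P hP => by
    rw [← card_sensorPositions]
    exact (resolvesIoc_sensorPositions hT hS hP).lowerComplexity_le
  unfold leafPathSensors
  by_cases hdef : ∃ P ∈ leafPaths T v,
      (S ∩ pathTail P).card < upperComplexity k (pathLength T P)
  · obtain ⟨P, hP, hPc⟩ := hdef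
    have h1 := Finset.le_sup (f := fun P => upperComplexity k (pathLength T P) -
      lowerComplexity k (pathLength T P)) hP
    have h2 := hlow P hP
    have h3 : ∑ Q ∈ (leafPaths T v).erase P, (upperComplexity k (pathLength T Q) : ℤ) ≤
        ∑ Q ∈ (leafPaths T v).erase P, ((S ∩ pathTail Q).card : ℤ) := by
      refine Finset.sum_le_sum fun Q hQ => ?_
      obtain ⟨hQP, hQ⟩ := Finset.mem_erase.1 hQ
      by_contra hlt
      exact hQP (eq_of_card_lt_upperComplexity hT hS hQ hP (by omega) hPc)
    rw [← Finset.add_sum_erase _ _ hP, ← Finset.add_sum_erase _ _ hP]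
    omega
  · push Not at hdef
    have : ∑ P ∈ leafPaths T v, (upperComplexity k (pathLength T P) : ℤ) ≤
        ∑ P ∈ leafPaths T v, ((S ∩ pathTail P).card : ℤ) :=
      Finset.sum_le_sum fun P hP => by exact_mod_cast hdef P hP
    omega

end Sensors

end LeafPathGeometry

/-! ### Replacing leaf-path sensors by support vertices -/

section Reduction

variable {V : Type*} [Fintype V] [DecidableEq V] {T : SimpleGraph V} {k : ℕ} {S : Finset V}

/-- If the sensors in `S` measure and tell apart all vertices in `W`, then `W` is bounded in terms
of `S`. -/
theorem three_mul_card_le (hT : T.IsTree) (hk : 1 ≤ k) {W : Finset V} (hS : S.Nonempty)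
    (hres : ∀ x ∈ W, ∀ y ∈ W, x ≠ y →
      ∃ s ∈ S, min (T.dist s x) (k + 1) ≠ min (T.dist s y) (k + 1))
    (hmeas : ∀ x ∈ W, ∃ s ∈ S, T.dist s x ≤ k) :
    3 * W.card + k ^ 2 + k + (if k ≡ 1 [MOD 3] then 1 else 0) ≤ S.card * gain k := by
  have h1 : W.card ≤ (signatures T k S).card := by
    refine Finset.card_le_card_of_injOn (signature T k S)
      (fun x hx => mem_signatures.2 ⟨x, rfl, hmeas x hx⟩) fun x hx y hy hxy => ?_
    by_contra hne
    obtain ⟨s, hs, h⟩ := hres x hx y hy hne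
    rw [← signature_apply hs, ← signature_apply hs, hxy] at h
    exact h rfl
  obtain ⟨m, hm⟩ := Nat.exists_eq_add_one_of_ne_zero hS.card_pos.ne'
  have h2 := three_mul_card_signatures_le hT hk m S hm
  rw [hm, Nat.add_mul, one_mul]
  -- `gain k - 3 * (k + 1)`, the deficit of the first sensor, is the constant term `k² + k` plus the
  -- indicator.
  have hg : gain k = k ^ 2 + 4 * k + 3 + if k ≡ 1 [MOD 3] then 1 else 0 := rfl
  omega

variable (T) [DecidableRel T.Adj]

/-- The leaf-paths at the support vertices. -/
def supportLeafPaths : Finset (Σ v : V, Σ w : V, T.Path v w) :=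
  (supportVertices T).sigma (leafPaths T)

/-- The vertices on the leaf-paths at the support vertices, without the support vertices. -/
def leafPathVertices : Finset V := (supportLeafPaths T).biUnion fun X => pathTail X.2

variable {T}

theorem card_inter_leafPathVertices (hT : T.IsTree) (S : Finset V) :
    (S ∩ leafPathVertices T).card =
      ∑ v ∈ supportVertices T, ∑ P ∈ leafPaths T v, (S ∩ pathTail P).card := by
  rw [leafPathVertices, Finset.inter_biUnion, Finset.card_biUnion, supportLeafPaths,
    Finset.sum_sigma]
  intro X hX Y hY hne
  exact (disjoint_pathTail hT (Finset.mem_sigma.1 hX).2 (Finset.mem_sigma.1 hY).2 hne).mono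
    Finset.inter_subset_right Finset.inter_subset_right

theorem exists_support_dist_eq (hT : T.IsTree) {s : V} (hs : s ∈ leafPathVertices T) :
    ∃ v ∈ supportVertices T, ∀ x, x ∉ leafPathVertices T →
      T.dist s x = T.dist s v + T.dist v x := by
  obtain ⟨⟨v, P⟩, hX, hs⟩ := Finset.mem_biUnion.1 hs
  obtain ⟨hv, hP⟩ := Finset.mem_sigma.1 hX
  refine ⟨v, hv, fun x hx => ?_⟩
  have hxP : x ∉ pathTail P := fun h => hx (Finset.mem_biUnion.2 ⟨⟨v, P⟩, hX, h⟩)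
  have := (mem_leafPaths.1 hP).dist_eq_add hT (mem_pathTail.1 hs).2 (eq_of_notMem_pathTail hxP)
  rw [T.dist_comm, this, T.dist_comm (u := x), T.dist_comm (u := v) (v := s), add_comm]

/-- A sensor on a leaf-path reads, off these paths, the distance to its support vertex plus a
constant. The support vertex therefore measures and tells apart there whatever the sensor does. -/
theorem three_mul_card_compl_le (hT : T.IsTree) (hk : 1 ≤ k) (hS : IsThresholdResolving T k S) :
    3 * (leafPathVertices T)ᶜ.card + k ^ 2 + k + (if k ≡ 1 [MOD 3] then 1 else 0) ≤
      (S \ leafPathVertices T ∪ supportVertices T).card * gain k := by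
  have hc := hT.connected
  obtain ⟨hres, hmeas⟩ := (isThresholdResolving_iff hc).1 hS
  refine three_mul_card_le hT hk ?_ ?_ ?_
  · obtain ⟨z⟩ := hc.nonempty
    obtain ⟨s, hs, -⟩ := hmeas z
    by_cases hsU : s ∈ leafPathVertices T
    · obtain ⟨v, hv, -⟩ := exists_support_dist_eq hT hsU
      exact ⟨v, Finset.mem_union_right _ hv⟩
    · exact ⟨s, Finset.mem_union_left _ (Finset.mem_sdiff.2 ⟨hs, hsU⟩)⟩
  · intro x hx y hy hxy
    obtain ⟨s, hs, h⟩ := hres x y hxy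
    by_cases hsU : s ∈ leafPathVertices T
    · obtain ⟨v, hv, hd⟩ := exists_support_dist_eq hT hsU
      refine ⟨v, Finset.mem_union_right _ hv, fun he => h ?_⟩
      rw [hd x (Finset.mem_compl.1 hx), hd y (Finset.mem_compl.1 hy)]
      omega
    · exact ⟨s, Finset.mem_union_left _ (Finset.mem_sdiff.2 ⟨hs, hsU⟩), h⟩
  · intro x hx
    obtain ⟨s, hs, h⟩ := hmeas x
    by_cases hsU : s ∈ leafPathVertices T
    · obtain ⟨v, hv, hd⟩ := exists_support_dist_eq hT hsU
      refine ⟨v, Finset.mem_union_right _ hv, ?_⟩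
      rw [hd x (Finset.mem_compl.1 hx)] at h
      omega
    · exact ⟨s, Finset.mem_union_left _ (Finset.mem_sdiff.2 ⟨hs, hsU⟩), h⟩

end Reduction

end ThresholdDim

/-! ### The lower bound -/

theorem mainTheorem3 {V : Type*} [Fintype V] [DecidableEq V] (T : SimpleGraph V)
    [DecidableRel T.Adj] (hT : T.IsTree) (n : ℕ) (hn : Fintype.card V = n)
    (k : ℕ) (hk : 1 ≤ k) :
    (ThresholdDim.tmd T k : ℤ) ≥
      ⌈(3 * (n : ℚ)
          - 3 * (∑ v ∈ ThresholdDim.supportVertices T,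
              ∑ P ∈ ThresholdDim.leafPaths T v, (ThresholdDim.pathLength T P : ℚ))
          + (k : ℚ) ^ 2 + (k : ℚ) + (if k ≡ 1 [MOD 3] then 1 else 0))
        / ((k : ℚ) ^ 2 + 4 * (k : ℚ) + 3 + (if k ≡ 1 [MOD 3] then 1 else 0))⌉
      + ∑ v ∈ ThresholdDim.supportVertices T, ThresholdDim.leafPathSensors T k v
      - ((ThresholdDim.supportVertices T).card : ℤ) := by
  open ThresholdDim in
  obtain ⟨S, hS, hcard⟩ := exists_card_eq_tmd T k
  have hR : ∑ v ∈ supportVertices T, leafPathSensors T k v ≤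
      ((S ∩ leafPathVertices T).card : ℤ) := by
    rw [card_inter_leafPathVertices hT]
    push_cast
    exact Finset.sum_le_sum fun v _ => leafPathSensors_le hT hS v
  have hU : (leafPathVertices T).card =
      ∑ v ∈ supportVertices T, ∑ P ∈ leafPaths T v, pathLength T P := by
    rw [← Finset.univ_inter (leafPathVertices T), card_inter_leafPathVertices hT]
    simp only [Finset.univ_inter, card_pathTail]
  have hcompl := Finset.card_compl_add_card (leafPathVertices T)
  rw [hn, hU] at hcompl
  have hmain := three_mul_card_compl_le hT hk hS
  have hunion := Finset.card_union_le (S \ leafPathVertices T) (supportVertices T)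
  have hsdiff := Finset.card_sdiff_add_card_inter S (leafPathVertices T)
  have hceil : ⌈(3 * (n : ℚ)
          - 3 * (∑ v ∈ supportVertices T, ∑ P ∈ leafPaths T v, (pathLength T P : ℚ))
          + (k : ℚ) ^ 2 + (k : ℚ) + (if k ≡ 1 [MOD 3] then 1 else 0))
        / ((k : ℚ) ^ 2 + 4 * (k : ℚ) + 3 + (if k ≡ 1 [MOD 3] then 1 else 0))⌉ ≤
      ((S \ leafPathVertices T ∪ supportVertices T).card : ℤ) := by
    have hn' := congrArg (Nat.cast (R := ℚ)) hcompl
    have hmain' := Nat.cast_le (α := ℚ).2 hmain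
    unfold gain at hmain'
    push_cast at hn' hmain'
    rw [Int.ceil_le, div_le_iff₀ (by split_ifs <;> positivity), Int.cast_natCast]
    linarith
  -- The two bounds add up over `|S| = |S ∩ U| + |S \ U|`; the added support vertices cost at most
  -- `|F_T|`, which is subtracted.
  omega
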